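/- **Theorem 2.9.** Let $n\ge 2$ be even and let $G=SD_{8n}=\langle a,b\mid a^{4n}=b^2=1,\ bab=a^{2n-1}\rangle$, regarded as a permutation group on the $4n$ residues modulo $4n$ through $a\mapsto (t\mapsto t+1)$, $b\mapsto (t\mapsto (2n-1)t)$. Let $V$ be an $m$-dimensional complex inner product space. For a character $\chi$ of $G$ let $V^{4n}_\chi(G)$ be the image of the operator $\frac{\chi(1)}{|G|}\sum_{\sigma\in G}\chi(\sigma)P_\sigma$ on $V^{\otimes 4n}$, where $P_\sigma(\otimes_t v_t)=\otimes_t v_{\sigma^{-1}(t)}$. Put $C^\dagger_{even}=\{2,4,\dots,2n-2\}$ and $C^\dagger_{odd}=\{1,3,\dots,n-1\}\cup\{2n+1,2n+3,\dots,3n-1\}$, and let $\overline{C^\dagger_{odd}}$ be the set of remainders of $s(2n-1)$ modulo $4n$ for $s\in C^\dagger_{odd}$. Let $\chi_0,\chi_1,\chi_2,\chi_3$ be the linear characters of $G$ with $(\chi_j(a),\chi_j(b))=(1,1),(1,-1),(-1,1),(-1,-1)$, respectively. With $\omega=e^{i\pi/2n}$, let $\rho^h$ be the representation of $G$ on $\mathbb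 C^2$ with $\rho^h(a)=\mathrm{diag}(\omega^h,\omega^{(2n-1)h})$ and $\rho^h(b)=\begin{pmatrix}0&1\\1&0\end{pmatrix}$; let $\varsigma_h$ be its character for $h\in C^\dagger_{even}$, and let $\psi_{h'}$ be the character of $\rho^{h'}$ for $h'\in C^\dagger_{odd}$. Then $$\dim V^{4n}_{\chi_0}(G)=\frac1{8n}\Big[2nm^n+2nm^{2n+1}+\sum_{k=0}^{4n-1}m^{\gcd(4n,k)}\Big],$$ $$\dim V^{4n}_{\chi_1}(G)=\frac1{8n}\Big[-2nm^n-2nm^{2n+1}+\sum_{k=0}^{4n-1}m^{\gcd(4n,k)}\Big],$$ $$\dim V^{4n}_{\chi_2}(G)=\frac1{8n}\Big[m^{4n}+m^{2n}+2\sum_{k\in C^\dagger_{even}}m^{\gcd(4n,k)}-\sum_{k\in C^\dagger_{odd}\cup\overline{C^\dagger_{odd}}}m^{\gcd(4n,k)}+2nm^{2n+1}-2nm^n\Big],$$ $$\dim V^{4n}_{\chi_3}(G)=\frac1{8n}\Big[m^{4n}+m^{2n}+2\sum_{k\in C^\dagger_{even}}m^{\gcd(4n,k)}-\sum_{k\in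 C^\dagger_{odd}\cup\overline{C^\dagger_{odd}}}m^{\gcd(4n,k)}-2nm^{2n+1}+2nm^n\Big],$$ and, for every $h\in C^\dagger_{even}$ and every $h'\in C^\dagger_{odd}$, $$\dim V^{4n}_{\varsigma_h}(G)=\frac1{2n}\sum_{k=0}^{4n-1}m^{\gcd(4n,k)}\cos\Big(\frac{hk\pi}{2n}\Big),$$ $$\dim V^{4n}_{\psi_{h'}}(G)=\frac1{4n}\Big[2m^{4n}-2m^{2n}+4\sum_{k\in C^\dagger_{even}}m^{\gcd(4n,k)}\cos\Big(\frac{h'k\pi}{2n}\Big)\Big].$$ -/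

import Mathlib

open scoped TensorProduct

noncomputable section

namespace SemiDihedral

/-! ### Symmetry classes of tensors -/

/-- The operator `T(G, χ) = (χ(1) / |G|) ∑_{g ∈ G} χ(g) P_g` on `⨂_{i ∈ ι} V`, for a finite group `G`
acting on the index set `ι` through `T : G →* Equiv.Perm ι`. Here `P_g` is `reindex` along `T g`:
it sends `⨂ i, v i` to `⨂ i, v ((T g)⁻¹ i)`. -/
def symmetrizer {G ι : Type*} [Group G] [Fintype G] (T : G →* Equiv.Perm ι) (χ : G → ℂ)
    (V : Type*) [AddCommGroup V] [Module ℂ V] :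
    (⨂[ℂ] _ : ι, V) →ₗ[ℂ] (⨂[ℂ] _ : ι, V) :=
  (χ 1 / (Fintype.card G : ℂ)) •
    ∑ g : G, χ g • (PiTensorProduct.reindex ℂ (fun _ : ι => V) (T g)).toLinearMap

/-- The symmetry class of tensors associated with `G` and `χ`: the image of `T(G, χ)`. -/
def symmetryClass {G ι : Type*} [Group G] [Fintype G] (T : G →* Equiv.Perm ι) (χ : G → ℂ)
    (V : Type*) [AddCommGroup V] [Module ℂ V] : Submodule ℂ (⨂[ℂ] _ : ι, V) :=
  LinearMap.range (symmetrizer T χ V)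

/-! ### The semi-dihedral group of order `8n` -/

/-- The two generators of the semi-dihedral group. -/
inductive Gen
  | a
  | b

/-- The relators of `⟨a, b ∣ a ^ (4n) = b ^ 2 = 1, b a b = a ^ (2n - 1)⟩`. -/
def rels (n : ℕ) : Set (FreeGroup Gen) :=
  {FreeGroup.of Gen.a ^ (4 * n), FreeGroup.of Gen.b ^ 2,
    FreeGroup.of Gen.b * FreeGroup.of Gen.a * FreeGroup.of Gen.b *
      (FreeGroup.of Gen.a ^ (2 * n - 1))⁻¹}

/-- The semi-dihedral group `SD_{8n} = ⟨a, b ∣ a ^ (4n) = b ^ 2 = 1, b a b = a ^ (2n - 1)⟩`. -/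
abbrev SD (n : ℕ) : Type := PresentedGroup (rels n)

/-- The homomorphism out of `SD_{8n}` determined by images of `a` and `b` satisfying the
relations. -/
def lift {H : Type*} [Group H] (n : ℕ) (x y : H) (h₁ : x ^ (4 * n) = 1) (h₂ : y ^ 2 = 1)
    (h₃ : y * x * y = x ^ (2 * n - 1)) : SD n →* H :=
  PresentedGroup.toGroup (rels := rels n) (f := fun g => Gen.casesOn g x y) (by
    intro r hr
    simp only [rels, Set.mem_insert_iff, Set.mem_singleton_iff] at hr
    rcases hr with rfl | rfl | rfl
    · simpa using h₁
    · simpa using h₂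
    · simpa [mul_inv_eq_one] using h₃)

section Finiteness

variable (n : ℕ)

theorem a_pow : (PresentedGroup.of Gen.a : SD n) ^ (4 * n) = 1 :=
  PresentedGroup.one_of_mem (rels := rels n) (by simp [rels])

theorem b_sq : (PresentedGroup.of Gen.b : SD n) ^ 2 = 1 :=
  PresentedGroup.one_of_mem (rels := rels n) (by simp [rels])

theorem b_a_b : (PresentedGroup.of Gen.b : SD n) * PresentedGroup.of Gen.a * PresentedGroup.of Gen.b
    = PresentedGroup.of Gen.a ^ (2 * n - 1) :=
  PresentedGroup.mk_eq_mk_of_mul_inv_mem (rels := rels n)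
    (x := FreeGroup.of Gen.b * FreeGroup.of Gen.a * FreeGroup.of Gen.b)
    (y := FreeGroup.of Gen.a ^ (2 * n - 1)) (by simp [rels])

instance [NeZero n] : Finite (SD n) := by
  set a : SD n := PresentedGroup.of Gen.a with ha
  set b : SD n := PresentedGroup.of Gen.b with hb
  have hn : 0 < 4 * n := by have := NeZero.pos n; omega
  have h1 : a ^ (4 * n) = 1 := a_pow n
  have h2 : b ^ 2 = 1 := b_sq n
  have hbb : b * b = 1 := by rw [← sq, h2]
  have h3 : b * a * b = a ^ (2 * n - 1) := b_a_b n
  have hbinv : b⁻¹ = b := inv_eq_of_mul_eq_one_left hbb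
  have hba : ∀ k : ℤ, b * a ^ k * b = a ^ (((2 * n - 1 : ℕ) : ℤ) * k) := by
    intro k
    have : b * a ^ k * b⁻¹ = (b * a * b⁻¹) ^ k := (conj_zpow).symm
    rw [hbinv, h3] at this
    rw [this, zpow_mul, zpow_natCast]
  have hfa : (Subgroup.zpowers a : Set (SD n)).Finite :=
    (isOfFinOrder_iff_pow_eq_one.2 ⟨4 * n, hn, h1⟩).finite_zpowers
  have hfb : (Subgroup.zpowers b : Set (SD n)).Finite :=
    (isOfFinOrder_iff_pow_eq_one.2 ⟨2, by norm_num, h2⟩).finite_zpowers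
  have key : ∀ g : SD n, (∃ k : ℤ, g = a ^ k) ∨ (∃ k : ℤ, g = b * a ^ k) := by
    intro g
    have hg : g ∈ Subgroup.closure (Set.range (PresentedGroup.of (rels := rels n))) := by
      rw [PresentedGroup.closure_range_of]; trivial
    induction hg using Subgroup.closure_induction with
    | mem x hx =>
      obtain ⟨i, rfl⟩ := hx
      cases i with
      | a => exact Or.inl ⟨1, by simp [ha]⟩
      | b => exact Or.inr ⟨0, by simp [hb]⟩
    | one => exact Or.inl ⟨0, by simp⟩
    | mul x y _ _ hx hy =>
      have hab : ∀ k : ℤ, a ^ k * b = b * a ^ (((2 * n - 1 : ℕ) : ℤ) * k) := by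
        intro k
        rw [← hba k, ← mul_assoc, ← mul_assoc, hbb, one_mul]
      rcases hx with ⟨k, rfl⟩ | ⟨k, rfl⟩ <;> rcases hy with ⟨l, rfl⟩ | ⟨l, rfl⟩
      · exact Or.inl ⟨k + l, by rw [zpow_add]⟩
      · exact Or.inr ⟨((2 * n - 1 : ℕ) : ℤ) * k + l, by
          rw [← mul_assoc, hab, mul_assoc, zpow_add]⟩
      · exact Or.inr ⟨k + l, by rw [zpow_add, mul_assoc]⟩
      · exact Or.inl ⟨((2 * n - 1 : ℕ) : ℤ) * k + l, by
          rw [← mul_assoc, hba, zpow_add]⟩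
    | inv x _ hx =>
      rcases hx with ⟨k, rfl⟩ | ⟨k, rfl⟩
      · exact Or.inl ⟨-k, by simp⟩
      · refine Or.inr ⟨((2 * n - 1 : ℕ) : ℤ) * (-k), ?_⟩
        rw [← hba (-k), ← mul_assoc, ← mul_assoc, hbb, one_mul, mul_inv_rev, hbinv, zpow_neg]
  have hfin : ((Subgroup.zpowers a : Set (SD n)) ∪
      (fun x => b * x) '' (Subgroup.zpowers a : Set (SD n))).Finite := hfa.union (hfa.image _)
  refine Set.finite_univ_iff.1 (hfin.subset ?_)
  intro g _
  rcases key g with ⟨k, rfl⟩ | ⟨k, rfl⟩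
  · exact Or.inl ⟨k, rfl⟩
  · exact Or.inr ⟨a ^ k, ⟨k, rfl⟩, rfl⟩

instance [NeZero n] : Fintype (SD n) := Fintype.ofFinite _

end Finiteness

/-! ### The action on `4n` points -/

theorem two_mul_sub_one_sq (n : ℕ) : ((2 * n - 1 : ZMod (4 * n))) * (2 * n - 1) = 1 := by
  have h : (4 * n : ZMod (4 * n)) = 0 := by exact_mod_cast ZMod.natCast_self (4 * n)
  linear_combination ((n : ZMod (4 * n)) - 1) * h

/-- The permutation `t ↦ t + 1` of the residues modulo `4n`. -/
def permA (n : ℕ) : Equiv.Perm (ZMod (4 * n)) := Equiv.addRight 1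

/-- The permutation `t ↦ (2n - 1) t` of the residues modulo `4n`. -/
def permB (n : ℕ) : Equiv.Perm (ZMod (4 * n)) where
  toFun t := (2 * n - 1) * t
  invFun t := (2 * n - 1) * t
  left_inv t := by simp only [← mul_assoc, two_mul_sub_one_sq, one_mul]
  right_inv t := by simp only [← mul_assoc, two_mul_sub_one_sq, one_mul]

theorem permA_pow (n k : ℕ) (t : ZMod (4 * n)) : (permA n ^ k) t = t + k := by
  simp [permA]

/-- The homomorphism `SD_{8n} → S_{4n}` with `a ↦ (t ↦ t + 1)` and `b ↦ (t ↦ (2n - 1) t)`, where the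
`4n` points are the residues modulo `4n`. -/
def toPerm (n : ℕ) [NeZero n] : SD n →* Equiv.Perm (ZMod (4 * n)) :=
  lift n (permA n) (permB n)
    (by
      ext1 t
      rw [permA_pow, ZMod.natCast_self]; simp)
    (by
      ext1 t
      rw [sq, Equiv.Perm.mul_apply]
      exact (permB n).left_inv t)
    (by
      ext1 t
      rw [permA_pow, Equiv.Perm.mul_apply, Equiv.Perm.mul_apply]
      have h1 : 1 ≤ 2 * n := by have := NeZero.pos n; omega
      simp only [permA, permB, Equiv.coe_fn_mk, Equiv.coe_addRight]
      push_cast [Nat.cast_sub h1]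
      linear_combination t * two_mul_sub_one_sq n)

/-! ### Characters -/

theorem sign_relation (n : ℕ) [NeZero n] (x y : ℂˣ) (hx : x ^ 2 = 1) (hy : y ^ 2 = 1) :
    y * x * y = x ^ (2 * n - 1) := by
  obtain ⟨k, rfl⟩ : ∃ k, n = k + 1 := Nat.exists_eq_succ_of_ne_zero (NeZero.ne n)
  have h : 2 * (k + 1) - 1 = 2 * k + 1 := by omega
  rw [h, pow_succ, pow_mul, hx, one_pow, one_mul, mul_right_comm, ← sq, hy, one_mul]

/-- The linear character of `SD_{8n}` with `a ↦ x`, `b ↦ y`, where `x, y ∈ {1, -1}`. -/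
def linearChar (n : ℕ) [NeZero n] (x y : ℂˣ) (hx : x ^ 2 = 1) (hy : y ^ 2 = 1) : SD n →* ℂˣ :=
  lift n x y (by rw [show 4 * n = 2 * (2 * n) by ring, pow_mul, hx, one_pow]) hy
    (sign_relation n x y hx hy)

/-- `χ₀(a) = 1`, `χ₀(b) = 1`. -/
def chi0 (n : ℕ) [NeZero n] (g : SD n) : ℂ := linearChar n 1 1 (by simp) (by simp) g

/-- `χ₁(a) = 1`, `χ₁(b) = -1`. -/
def chi1 (n : ℕ) [NeZero n] (g : SD n) : ℂ := linearChar n 1 (-1) (by simp) (by simp) g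

/-- `χ₂(a) = -1`, `χ₂(b) = 1`. -/
def chi2 (n : ℕ) [NeZero n] (g : SD n) : ℂ := linearChar n (-1) 1 (by simp) (by simp) g

/-- `χ₃(a) = -1`, `χ₃(b) = -1`. -/
def chi3 (n : ℕ) [NeZero n] (g : SD n) : ℂ := linearChar n (-1) (-1) (by simp) (by simp) g

/-- `ω = exp (iπ / (2n))`. -/
def omega (n : ℕ) : ℂ := Complex.exp (Complex.I * Real.pi / (2 * n))

theorem omega_ne_zero (n : ℕ) : omega n ≠ 0 := Complex.exp_ne_zero _

theorem omega_pow (n : ℕ) [NeZero n] : omega n ^ (4 * n) = 1 := by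
  have hn : (n : ℂ) ≠ 0 := by exact_mod_cast NeZero.ne n
  rw [omega, ← Complex.exp_nat_mul, ← Complex.exp_two_pi_mul_I]
  congr 1
  push_cast
  field_simp
  ring

/-- The matrix `diag (ω ^ h, ω ^ ((2n - 1) h))`. -/
def matA (n h : ℕ) : GL (Fin 2) ℂ :=
  Matrix.GeneralLinearGroup.mkOfDetNeZero
    !![omega n ^ h, 0; 0, omega n ^ ((2 * n - 1) * h)]
    (by simp [Matrix.det_fin_two, omega_ne_zero])

/-- The matrix exchanging the two coordinates. -/
def matB : GL (Fin 2) ℂ :=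
  Matrix.GeneralLinearGroup.mkOfDetNeZero !![0, 1; 1, 0] (by simp [Matrix.det_fin_two])

theorem coe_matA_pow (n h k : ℕ) : ((matA n h ^ k : GL (Fin 2) ℂ) : Matrix (Fin 2) (Fin 2) ℂ) =
    !![omega n ^ (h * k), 0; 0, omega n ^ ((2 * n - 1) * h * k)] := by
  induction k with
  | zero =>
    ext i j
    fin_cases i <;> fin_cases j <;> simp
  | succ k ih =>
    rw [pow_succ, Units.val_mul, ih]
    simp [matA, Matrix.GeneralLinearGroup.mkOfDetNeZero, ← pow_add, mul_add]

theorem coe_matB : (matB : Matrix (Fin 2) (Fin 2) ℂ) = !![0, 1; 1, 0] := rfl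

theorem omega_pow_sq (n h : ℕ) [NeZero n] :
    omega n ^ ((2 * n - 1) * h * (2 * n - 1)) = omega n ^ h := by
  obtain ⟨k, rfl⟩ : ∃ k, n = k + 1 := Nat.exists_eq_succ_of_ne_zero (NeZero.ne n)
  have e : (2 * (k + 1) - 1) * h * (2 * (k + 1) - 1) = 4 * (k + 1) * (k * h) + h := by
    have h' : 2 * (k + 1) - 1 = 2 * k + 1 := by omega
    rw [h']; ring
  rw [e, pow_add, pow_mul, omega_pow, one_pow, one_mul]

/-- The two-dimensional matrix representation `ρ^h` of `SD_{8n}`, with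
`ρ^h(a) = diag (ω ^ h, ω ^ ((2n - 1) h))` and `ρ^h(b)` exchanging the coordinates. -/
def rho (n : ℕ) [NeZero n] (h : ℕ) : SD n →* GL (Fin 2) ℂ :=
  lift n (matA n h) matB
    (by
      apply Units.ext
      rw [coe_matA_pow, mul_comm h, pow_mul, omega_pow, mul_comm _ (4 * n), pow_mul, omega_pow,
        one_pow, one_pow, Units.val_one, Matrix.one_fin_two])
    (by
      apply Units.ext
      rw [sq, Units.val_mul, coe_matB]
      simp [Matrix.one_fin_two])
    (by
      apply Units.ext
      rw [coe_matA_pow, omega_pow_sq, Units.val_mul, Units.val_mul, coe_matB,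
        ← pow_one (matA n h), coe_matA_pow]
      simp [mul_comm h])

/-- The character of `ρ^h`, `g ↦ tr ρ^h(g)`. For `h` in `CdagEven n` it is written `ς_h`, for `h` in
`CdagOdd n` it is written `ψ_h`. -/
def rhoChar (n : ℕ) [NeZero n] (h : ℕ) (g : SD n) : ℂ :=
  Matrix.trace (rho n h g : Matrix (Fin 2) (Fin 2) ℂ)

/-! ### Index sets -/

/-- `C₁ = {0, 2, 4, …, 2n}`. -/
def C1 (n : ℕ) : Finset ℕ := (Finset.range (2 * n + 1)).filter Even

/-- `{1, 3, 5, …, n - 1}` for even `n`. -/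
def C2even (n : ℕ) : Finset ℕ := (Finset.Icc 1 (n - 1)).filter Odd

/-- `{2n + 1, 2n + 3, …, 3n - 1}` for even `n`. -/
def C3even (n : ℕ) : Finset ℕ := (Finset.Icc (2 * n + 1) (3 * n - 1)).filter Odd

/-- `C₁ ∖ {0, 2n} = {2, 4, …, 2n - 2}`. -/
def CdagEven (n : ℕ) : Finset ℕ := C1 n \ {0, 2 * n}

/-- `{1, 3, …, n - 1} ∪ {2n + 1, 2n + 3, …, 3n - 1}` for even `n`. -/
def CdagOdd (n : ℕ) : Finset ℕ := C2even n ∪ C3even n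

/-- `S̄`: the remainders of `s (2n - 1)` modulo `4n`, for `s ∈ S`. -/
def bar (n : ℕ) (S : Finset ℕ) : Finset ℕ := S.image fun s => s * (2 * n - 1) % (4 * n)

end SemiDihedral

end

/-! For an irreducible character the symmetrizer is a projection, so the dimension of its image is
its trace. The operator `P_σ` permutes the tensor basis, and its trace is `m` to the number of
cycles of `σ`. Hence every dimension is `χ(1)/|G| ∑ χ(g) m^(cycles of g)` (`finrank_symmetryClass`).

The group consists of the `8n` distinct elements `a^k` and `a^k b` (`sum_SD`). The translation `a^k`
has `gcd(4n, k)` cycles. The square of `a^k b` is translation by `2nk`: for odd `k` all cycles have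
length 4, giving `n` cycles; for even `k` it is an involution, with two fixed points because `n` is
even, giving `2n + 1` cycles.

Idempotency needs only the convolution identity for `χ`. It is immediate for linear characters; for
`ρ^h` it is a geometric-sum computation, valid as soon as the two eigenvalues of `ρ^h(a)` differ
(`rhoChar_convolution`). The two-dimensional characters vanish on every `a^k b`, so only
translations contribute. The stated index sets and cosines come from the symmetry `k ↦ 4n - k` and
from the reflections that multiplication by `2n - 1` induces on odd residues. -/

noncomputable section

namespace SemiDihedral

/-! ### Symmetrizers as projections, traces and cycle counts -/

section General

/-- The representation of `G` on `⨂_{i ∈ ι} V` permuting the tensor factors. -/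
def permRep {G ι : Type*} [Group G] (T : G →* Equiv.Perm ι)
    (V : Type*) [AddCommGroup V] [Module ℂ V] :
    G →* Module.End ℂ (⨂[ℂ] _ : ι, V) where
  toFun g := (PiTensorProduct.reindex ℂ (fun _ : ι => V) (T g)).toLinearMap
  map_one' := by
    rw [map_one]
    exact congrArg LinearEquiv.toLinearMap
      (PiTensorProduct.reindex_refl (R := ℂ) (s := fun _ : ι => V))
  map_mul' g h := by
    ext v
    simp only [LinearMap.compMultilinearMap_apply, LinearEquiv.coe_coe,
      PiTensorProduct.reindex_tprod, Module.End.mul_apply, map_mul]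
    rfl

/-- Expanding the square and substituting `h ↦ g⁻¹ h` turns the coefficients into the convolution of
`χ` with itself. Irreducibility enters only through `hχ`. -/
theorem isIdempotentElem_sum_smul {G A : Type*} [Group G] [Fintype G] [Ring A] [Algebra ℂ A]
    (P : G →* A) (χ : G → ℂ) (c : ℂ)
    (hχ : ∀ h, c * ∑ g, χ g * χ (g⁻¹ * h) = χ h) :
    IsIdempotentElem (c • ∑ g, χ g • P g) := by
  have key : (∑ g, χ g • P g) * (∑ g, χ g • P g)
      = ∑ h, (∑ g, χ g * χ (g⁻¹ * h)) • P h := by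
    simp_rw [Finset.sum_mul_sum, Finset.sum_smul]
    rw [Finset.sum_comm]
    conv_rhs => rw [Finset.sum_comm]
    rw [Finset.sum_comm]
    refine Finset.sum_congr rfl fun g _ => ?_
    refine Fintype.sum_equiv (Equiv.mulLeft g) _ _ fun h => ?_
    simp [smul_smul, mul_comm]
  rw [IsIdempotentElem, smul_mul_smul_comm, key, mul_smul, Finset.smul_sum]
  simp_rw [smul_smul, hχ]

theorem finrank_range_eq_trace_of_isIdempotentElem {M : Type*} [AddCommGroup M] [Module ℂ M]
    [FiniteDimensional ℂ M] (f : Module.End ℂ M) (hf : IsIdempotentElem f) :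
    (Module.finrank ℂ (LinearMap.range f) : ℂ) = LinearMap.trace ℂ M f :=
  ((LinearMap.isProj_range_iff_isIdempotentElem f).2 hf).trace.symm

/-- The number of cycles of `σ`, fixed points included. -/
def cycleCount {ι : Type*} (σ : Equiv.Perm ι) : ℕ :=
  Nat.card (MulAction.orbitRel.Quotient (Subgroup.zpowers σ) ι)

/-- Colourings fixed by `σ` are colourings of the cycles of `σ`. -/
def fixedFunctionsEquiv {ι κ : Type*} (σ : Equiv.Perm ι) :
    {p : ι → κ // (fun i => p (σ.symm i)) = p} ≃
      (MulAction.orbitRel.Quotient (Subgroup.zpowers σ) ι → κ) where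
  toFun p := Quotient.lift p.1 (by
    have hp : ∀ i, p.1 (σ i) = p.1 i := fun i => by
      have := congrFun p.2 (σ i)
      simpa using this.symm
    have hz : ∀ k : ℤ, ∀ i, p.1 ((σ ^ k) i) = p.1 i := by
      intro k
      induction k using Int.induction_on with
      | zero => simp
      | succ k ih => intro i; rw [zpow_add_one, Equiv.Perm.mul_apply, ih, hp]
      | pred k ih =>
        intro i
        rw [zpow_sub_one, Equiv.Perm.mul_apply, ih]
        simpa using (hp (σ⁻¹ i)).symm
    rintro i j ⟨⟨_, k, rfl⟩, rfl⟩
    exact hz k j)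
  invFun q := ⟨fun i => q (Quotient.mk _ i), by
    funext i
    refine congrArg q (Quotient.sound ?_)
    exact ⟨⟨σ⁻¹, -1, by simp⟩, rfl⟩⟩
  left_inv p := rfl
  right_inv q := by
    funext x
    induction x using Quotient.inductionOn
    rfl

/-- The tensor basis is indexed by functions `ι → Fin m` and is permuted by `σ`. The trace counts
the fixed functions, which are those constant on the cycles. -/
theorem trace_reindex {ι : Type*} [Fintype ι] (σ : Equiv.Perm ι)
    (V : Type*) [AddCommGroup V] [Module ℂ V] [FiniteDimensional ℂ V] :
    LinearMap.trace ℂ (⨂[ℂ] _ : ι, V)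
      (PiTensorProduct.reindex ℂ (fun _ : ι => V) σ).toLinearMap
      = (Module.finrank ℂ V : ℂ) ^ cycleCount σ := by
  classical
  let B := Basis.piTensorProduct fun _ : ι => Module.finBasis ℂ V
  have hB : ∀ p, PiTensorProduct.reindex ℂ (fun _ : ι => V) σ (B p)
      = B (fun i => p (σ.symm i)) := by
    intro p
    rw [Basis.piTensorProduct_apply, Basis.piTensorProduct_apply]
    exact PiTensorProduct.reindex_tprod σ _
  rw [LinearMap.trace_eq_matrix_trace ℂ B, Matrix.trace]
  simp_rw [Matrix.diag_apply, LinearMap.toMatrix_apply, LinearEquiv.coe_coe, hB,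
    Module.Basis.repr_self, Finsupp.single_apply]
  rw [Finset.sum_boole, ← Fintype.card_subtype, ← Nat.card_eq_fintype_card,
    Nat.card_congr (fixedFunctionsEquiv σ), Nat.card_fun]
  simp [cycleCount]

theorem finrank_symmetryClass {G ι : Type*} [Group G] [Fintype G] [Fintype ι]
    (T : G →* Equiv.Perm ι) (χ : G → ℂ)
    (V : Type*) [AddCommGroup V] [Module ℂ V] [FiniteDimensional ℂ V]
    (hχ : ∀ h, χ 1 / (Fintype.card G : ℂ) * ∑ g, χ g * χ (g⁻¹ * h) = χ h) :
    (Module.finrank ℂ (symmetryClass T χ V) : ℂ) = χ 1 / (Fintype.card G : ℂ) *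
      ∑ g, χ g * (Module.finrank ℂ V : ℂ) ^ cycleCount (T g) := by
  have h : IsIdempotentElem (symmetrizer T χ V) :=
    isIdempotentElem_sum_smul (permRep T V) χ _ hχ
  rw [symmetryClass, finrank_range_eq_trace_of_isIdempotentElem _ h, symmetrizer]
  simp_rw [map_smul, map_sum, map_smul, trace_reindex, smul_eq_mul]

/-- Burnside's lemma for the cyclic group generated by `σ`. -/
theorem cycleCount_mul_orderOf {ι : Type*} [Fintype ι] [DecidableEq ι] (σ : Equiv.Perm ι) :
    cycleCount σ * orderOf σ
      = ∑ j ∈ Finset.range (orderOf σ), (Finset.univ.filter fun i => (σ ^ j) i = i).card := by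
  classical
  have h := MulAction.sum_card_fixedBy_eq_card_orbits_mul_card_group (Subgroup.zpowers σ) ι
  rw [cycleCount, Nat.card_eq_fintype_card, ← Fintype.card_zpowers, ← h, Fintype.card_zpowers,
    ← Fin.sum_univ_eq_sum_range (fun j => (Finset.univ.filter fun i => (σ ^ j) i = i).card)]
  symm
  refine Fintype.sum_equiv (finEquivZPowers (isOfFinOrder_of_finite σ)) _ _ fun j => ?_
  rw [← Fintype.card_subtype, finEquivZPowers_apply]
  rfl

/-- If the nontrivial powers of `σ` have no fixed points, all cycles have length `orderOf σ`. -/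
theorem cycleCount_mul_orderOf_of_free {ι : Type*} [Fintype ι] [DecidableEq ι]
    (σ : Equiv.Perm ι)
    (h : ∀ j, j ≠ 0 → j < orderOf σ → ∀ i, (σ ^ j) i ≠ i) :
    cycleCount σ * orderOf σ = Fintype.card ι := by
  rw [cycleCount_mul_orderOf, Finset.sum_eq_single 0]
  · simp
  · intro j hj h0
    simpa [Finset.filter_eq_empty_iff] using h j h0 (Finset.mem_range.1 hj)
  · intro h0
    exact absurd (Finset.mem_range.2 (orderOf_pos σ)) h0

end General

/-! ### Normal forms in the semi-dihedral group -/

section Group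

/-- The generator `a` of `SD n`. -/
abbrev genA (n : ℕ) : SD n := PresentedGroup.of Gen.a

/-- The generator `b` of `SD n`. -/
abbrev genB (n : ℕ) : SD n := PresentedGroup.of Gen.b

theorem lift_genA {H : Type*} [Group H] (n : ℕ) (x y : H) (h₁ : x ^ (4 * n) = 1)
    (h₂ : y ^ 2 = 1) (h₃ : y * x * y = x ^ (2 * n - 1)) : lift n x y h₁ h₂ h₃ (genA n) = x :=
  PresentedGroup.toGroup.of _

theorem lift_genB {H : Type*} [Group H] (n : ℕ) (x y : H) (h₁ : x ^ (4 * n) = 1)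
    (h₂ : y ^ 2 = 1) (h₃ : y * x * y = x ^ (2 * n - 1)) : lift n x y h₁ h₂ h₃ (genB n) = y :=
  PresentedGroup.toGroup.of _

theorem genB_mul_genB (n : ℕ) : genB n * genB n = 1 := by rw [← sq]; exact b_sq n

theorem genB_mul_genA_pow (n k : ℕ) :
    genB n * genA n ^ k = genA n ^ ((2 * n - 1) * k) * genB n := by
  have hinv : (genB n)⁻¹ = genB n := inv_eq_of_mul_eq_one_left (genB_mul_genB n)
  have h : genB n * genA n * (genB n)⁻¹ = genA n ^ (2 * n - 1) := by rw [hinv]; exact b_a_b n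
  rw [pow_mul, ← h, conj_pow, inv_mul_cancel_right]

/-- The normal forms are stable under left multiplication by the generators and their inverses.
Natural exponents suffice since `a⁻¹ = a ^ (4n - 1)`. -/
theorem exists_eq_pow (n : ℕ) [NeZero n] (g : SD n) :
    (∃ k : ℕ, g = genA n ^ k) ∨ ∃ k : ℕ, g = genA n ^ k * genB n := by
  have hg : g ∈ Subgroup.closure (Set.range (PresentedGroup.of (rels := rels n))) := by
    rw [PresentedGroup.closure_range_of]; trivial
  have hA : (genA n)⁻¹ = genA n ^ (4 * n - 1) := by
    rw [inv_eq_iff_mul_eq_one, ← pow_succ', Nat.sub_add_cancel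
      (by have := NeZero.pos n; omega)]
    exact a_pow n
  have hB : (genB n)⁻¹ = genB n := inv_eq_of_mul_eq_one_left (genB_mul_genB n)
  have hAmul : ∀ (k : ℕ) (y : SD n),
      ((∃ k : ℕ, y = genA n ^ k) ∨ ∃ k : ℕ, y = genA n ^ k * genB n) →
      (∃ l : ℕ, genA n ^ k * y = genA n ^ l) ∨
        ∃ l : ℕ, genA n ^ k * y = genA n ^ l * genB n := by
    rintro k y (⟨l, rfl⟩ | ⟨l, rfl⟩)
    · exact Or.inl ⟨k + l, (pow_add _ _ _).symm⟩
    · exact Or.inr ⟨k + l, by rw [pow_add, mul_assoc]⟩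
  have hBmul : ∀ y : SD n,
      ((∃ k : ℕ, y = genA n ^ k) ∨ ∃ k : ℕ, y = genA n ^ k * genB n) →
      (∃ l : ℕ, genB n * y = genA n ^ l) ∨ ∃ l : ℕ, genB n * y = genA n ^ l * genB n := by
    rintro y (⟨l, rfl⟩ | ⟨l, rfl⟩)
    · exact Or.inr ⟨_, genB_mul_genA_pow n l⟩
    · exact Or.inl ⟨(2 * n - 1) * l, by
        rw [← mul_assoc, genB_mul_genA_pow, mul_assoc, genB_mul_genB, mul_one]⟩
  induction hg using Subgroup.closure_induction_left with
  | one => exact Or.inl ⟨0, (pow_zero _).symm⟩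
  | mul_left x hx y _ ih =>
    obtain ⟨i, rfl⟩ := hx
    cases i with
    | a => simpa using hAmul 1 y ih
    | b => exact hBmul y ih
  | inv_mul_cancel x hx y _ ih =>
    obtain ⟨i, rfl⟩ := hx
    cases i with
    | a => rw [hA]; exact hAmul _ y ih
    | b => rw [hB]; exact hBmul y ih

theorem genA_pow_mod (n k : ℕ) : genA n ^ (k % (4 * n)) = genA n ^ k := by
  conv_rhs => rw [← Nat.mod_add_div k (4 * n), pow_add, pow_mul, a_pow, one_pow, mul_one]

theorem toPerm_genA_pow_apply (n : ℕ) [NeZero n] (k : ℕ) (t : ZMod (4 * n)) :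
    toPerm n (genA n ^ k) t = t + k := by
  rw [map_pow, toPerm, lift_genA, permA_pow]

theorem toPerm_genA_pow_mul_genB_apply (n : ℕ) [NeZero n] (k : ℕ) (t : ZMod (4 * n)) :
    toPerm n (genA n ^ k * genB n) t = (2 * n - 1) * t + k := by
  rw [map_mul, Equiv.Perm.mul_apply, toPerm_genA_pow_apply, toPerm, lift_genB]
  rfl

/-- A presentation gives no lower bound on the group. Distinctness is detected by the action: `a ^
i` sends the point 0 to `i`. -/
theorem genA_pow_injOn (n : ℕ) [NeZero n] {i j : ℕ} (hi : i < 4 * n) (hj : j < 4 * n)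
    (h : genA n ^ i = genA n ^ j) : i = j := by
  have h0 := congrArg (fun g => toPerm n g 0) h
  simp only [toPerm_genA_pow_apply, zero_add] at h0
  rw [ZMod.natCast_eq_natCast_iff] at h0
  exact Nat.ModEq.eq_of_lt_of_lt h0 hi hj

/-- The linear character with `a ↦ 1`, `b ↦ -1` separates the two cosets of `⟨a⟩`. -/
theorem genA_pow_ne (n : ℕ) [NeZero n] (i j : ℕ) :
    genA n ^ i ≠ genA n ^ j * genB n := by
  intro h
  have h0 := congrArg (linearChar n 1 (-1) (by simp) (by simp)) h
  rw [map_mul, map_pow, map_pow, linearChar, lift_genA, lift_genB, one_pow, one_pow, one_mul] at h0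
  have h1 : ((1 : ℂˣ) : ℂ) = ((-1 : ℂˣ) : ℂ) := congrArg Units.val h0
  norm_num at h1

/-- The enumeration of `SD n` by normal forms `a ^ k` and `a ^ k * b`. -/
def normalForm (n : ℕ) [NeZero n] : Fin (4 * n) ⊕ Fin (4 * n) ≃ SD n :=
  Equiv.ofBijective (Sum.elim (fun k => genA n ^ (k : ℕ)) (fun k => genA n ^ (k : ℕ) * genB n)) (by
    have hn : 0 < 4 * n := by have := NeZero.pos n; omega
    constructor
    · rintro (i | i) (j | j) h
      · exact congrArg Sum.inl (Fin.ext (genA_pow_injOn n i.2 j.2 h))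
      · exact absurd h (genA_pow_ne n i j)
      · exact absurd h.symm (genA_pow_ne n j i)
      · exact congrArg Sum.inr (Fin.ext (genA_pow_injOn n i.2 j.2 (mul_right_cancel h)))
    · intro g
      rcases exists_eq_pow n g with ⟨k, rfl⟩ | ⟨k, rfl⟩
      · exact ⟨Sum.inl ⟨k % (4 * n), Nat.mod_lt _ hn⟩, genA_pow_mod n k⟩
      · exact ⟨Sum.inr ⟨k % (4 * n), Nat.mod_lt _ hn⟩,
          congrArg (· * genB n) (genA_pow_mod n k)⟩)

theorem sum_SD {M : Type*} [AddCommMonoid M] (n : ℕ) [NeZero n] (F : SD n → M) :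
    ∑ g, F g = ∑ k ∈ Finset.range (4 * n), F (genA n ^ k)
      + ∑ k ∈ Finset.range (4 * n), F (genA n ^ k * genB n) := by
  rw [← (normalForm n).sum_comp, Fintype.sum_sum_type,
    ← Fin.sum_univ_eq_sum_range (fun k => F (genA n ^ k)),
    ← Fin.sum_univ_eq_sum_range (fun k => F (genA n ^ k * genB n))]
  rfl

theorem card_SD (n : ℕ) [NeZero n] : Fintype.card (SD n) = 8 * n := by
  rw [← Fintype.card_congr (normalForm n), Fintype.card_sum, Fintype.card_fin]
  ring

/-! ### Cycle counts -/

/-- A nontrivial translation has no fixed point, so all cycles have length equal to the additive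
order of `k`, which is `4n / gcd(4n, k)`. -/
theorem cycleCount_genA_pow (n : ℕ) [NeZero n] (k : ℕ) :
    cycleCount (toPerm n (genA n ^ k)) = Nat.gcd (4 * n) k := by
  set σ := toPerm n (genA n ^ k) with hσ
  have hn : 4 * n ≠ 0 := by have := NeZero.ne n; omega
  have hpow : ∀ (j : ℕ) (t : ZMod (4 * n)), (σ ^ j) t = t + j * k := by
    intro j t
    rw [hσ, ← map_pow, ← pow_mul, toPerm_genA_pow_apply, mul_comm k j]
    push_cast
    rfl
  have hone : ∀ j : ℕ, σ ^ j = 1 ↔ (j : ZMod (4 * n)) * k = 0 := by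
    intro j
    constructor
    · intro h
      have := hpow j 0
      rw [h] at this
      simpa using this.symm
    · intro h
      ext1 t
      rw [hpow, h, add_zero]; rfl
  have hord : orderOf σ = 4 * n / Nat.gcd (4 * n) k := by
    rw [← ZMod.addOrderOf_coe k hn]
    -- The two orders agree because they have the same multiples.
    refine Nat.dvd_right_iff_eq.1 fun j => ?_
    rw [orderOf_dvd_iff_pow_eq_one, addOrderOf_dvd_iff_nsmul_eq_zero, hone, nsmul_eq_mul]
  have hfree := cycleCount_mul_orderOf_of_free σ (by
    intro j h0 hj t ht
    rw [hpow, add_eq_left] at ht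
    exact (Nat.le_of_dvd (Nat.pos_of_ne_zero h0)
      (orderOf_dvd_of_pow_eq_one ((hone j).2 ht))).not_gt hj)
  rw [ZMod.card, hord] at hfree
  have hd : Nat.gcd (4 * n) k * (4 * n / Nat.gcd (4 * n) k) = 4 * n :=
    Nat.mul_div_cancel' (Nat.gcd_dvd_left _ _)
  refine Nat.eq_of_mul_eq_mul_right (Nat.pos_of_ne_zero fun h => hn ?_) (hfree.trans hd.symm)
  rw [← hd, h, mul_zero]

theorem toPerm_genA_pow_mul_genB_sq_apply (n : ℕ) [NeZero n] (k : ℕ) (t : ZMod (4 * n)) :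
    (toPerm n (genA n ^ k * genB n) ^ 2) t = t + (2 * n * k : ℕ) := by
  rw [sq, Equiv.Perm.mul_apply, toPerm_genA_pow_mul_genB_apply, toPerm_genA_pow_mul_genB_apply]
  push_cast
  linear_combination t * two_mul_sub_one_sq n

/-- For odd `k` the square is translation by `2n`, which has order 2 and no fixed point, so every
cycle has length 4. -/
theorem cycleCount_of_odd (n : ℕ) [NeZero n] (k : ℕ) (hk : Odd k) :
    cycleCount (toPerm n (genA n ^ k * genB n)) = n := by
  set τ := toPerm n (genA n ^ k * genB n) with hτ
  have hn := NeZero.pos n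
  have hsq : ∀ t, (τ ^ 2) t = t + (2 * n * k : ℕ) := toPerm_genA_pow_mul_genB_sq_apply n k
  have h2 : ∀ t, (τ ^ 2) t ≠ t := by
    intro t ht
    rw [hsq, add_eq_left, ZMod.natCast_eq_zero_iff, show 4 * n = 2 * n * 2 by ring] at ht
    exact (Nat.not_even_iff_odd.2 hk)
      (even_iff_two_dvd.2 (Nat.dvd_of_mul_dvd_mul_left (by omega) ht))
  have h4 : τ ^ 4 = 1 := by
    ext1 t
    have : τ ^ 4 = τ ^ 2 * τ ^ 2 := by rw [← pow_add]
    rw [this, Equiv.Perm.mul_apply, hsq, hsq, add_assoc,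
      ← Nat.cast_add, show 2 * n * k + 2 * n * k = 4 * n * k by ring, Nat.cast_mul,
      ZMod.natCast_self]
    simp
  have hord : orderOf τ = 4 := by
    have := orderOf_eq_prime_pow (p := 2) (n := 1) (x := τ)
      (fun h => h2 0 (by rw [pow_one] at h; rw [h]; rfl)) h4
    simpa using this
  have hfree := cycleCount_mul_orderOf_of_free τ (by
    intro j h0 hj t ht
    rw [hord] at hj
    -- A point fixed by `τ` or `τ ^ 3` is fixed by `τ ^ 2` or `τ ^ 6 = τ ^ 2`, so every case
    -- contradicts `h2`.
    have hjj : (τ ^ (j * 2)) t = t := by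
      rw [pow_mul, sq, Equiv.Perm.mul_apply, ht, ht]
    interval_cases j
    · exact h0 rfl
    · exact h2 t hjj
    · exact h2 t ht
    · exact h2 t (by
        rw [show 3 * 2 = 4 + 2 from rfl, pow_add, h4, one_mul] at hjj
        exact hjj))
  rw [ZMod.card, hord] at hfree
  omega

theorem ZMod_two_mul_eq_zero (n : ℕ) [NeZero n] (x : ZMod (4 * n)) (hx : 2 * x = 0) :
    x = 0 ∨ x = 2 * n := by
  have hn := NeZero.pos n
  obtain ⟨v, hv, rfl⟩ : ∃ v : ℕ, v < 4 * n ∧ (v : ZMod (4 * n)) = x :=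
    ⟨x.val, ZMod.val_lt x, ZMod.natCast_zmod_val x⟩
  have h : ((2 * v : ℕ) : ZMod (4 * n)) = 0 := by exact_mod_cast hx
  rw [ZMod.natCast_eq_zero_iff] at h
  obtain ⟨c, hc⟩ := h
  have hc' : v = 2 * n * c := by linarith
  have : c < 2 := by
    by_contra hc2
    have : 2 * n * 2 ≤ 2 * n * c := Nat.mul_le_mul_left _ (by omega)
    omega
  interval_cases c
  · left; simp [hc']
  · right; simp [hc']

/-- Here the permutation is an involution with exactly two fixed points, so Burnside gives `(4n + 2)
/ 2` cycles. -/
theorem cycleCount_of_even (n : ℕ) [NeZero n] (hn : Even n) (k : ℕ) (hk : Even k) :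
    cycleCount (toPerm n (genA n ^ k * genB n)) = 2 * n + 1 := by
  set τ := toPerm n (genA n ^ k * genB n) with hτ
  have hn0 := NeZero.pos n
  have hap : ∀ t, τ t = (2 * n - 1) * t + k := toPerm_genA_pow_mul_genB_apply n k
  obtain ⟨l, hl⟩ := hk
  obtain ⟨r, hr⟩ := hn
  have hN : (4 * n : ZMod (4 * n)) = 0 := by exact_mod_cast ZMod.natCast_self (4 * n)
  have hkl : (k : ZMod (4 * n)) = 2 * l := by rw [hl]; push_cast; ring
  have hnr : (n : ZMod (4 * n)) = 2 * r := by rw [hr]; push_cast; ring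
  -- For even `n`, `n - 1` is its own inverse modulo `2n`. With `k = 2l` the fixed-point equation is
  -- `2 (n - 1) t = -2l`, so `t = -(n - 1) l` modulo `2n`, which lifts to two residues modulo `4n`.
  have hunit : 2 * ((n : ZMod (4 * n)) - 1) * (n - 1) = 2 := by
    linear_combination (r - 1 : ZMod (4 * n)) * hN + 2 * n * hnr
  have h2n : (2 * n : ZMod (4 * n)) ≠ 0 := by
    intro h
    have h' : ((2 * n : ℕ) : ZMod (4 * n)) = 0 := by exact_mod_cast h
    rw [ZMod.natCast_eq_zero_iff] at h'
    have := Nat.le_of_dvd (by omega) h'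
    omega
  have hfix : (Finset.univ.filter fun t => τ t = t)
      = {-((n - 1) * l : ZMod (4 * n)), -((n - 1) * l : ZMod (4 * n)) + 2 * n} := by
    ext t
    simp only [Finset.mem_filter, Finset.mem_univ, true_and, Finset.mem_insert,
      Finset.mem_singleton, hap, hkl]
    constructor
    · intro h
      rcases ZMod_two_mul_eq_zero n (t + (n - 1) * l) (by
        linear_combination (n - 1 : ZMod (4 * n)) * h - t * hunit) with h0 | h0
      · left; linear_combination h0
      · right; linear_combination h0
    · rintro (rfl | rfl)
      · linear_combination -(l : ZMod (4 * n)) * hunit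
      · linear_combination -(l : ZMod (4 * n)) * hunit + (n - 1 : ZMod (4 * n)) * hN
  have hcard : (Finset.univ.filter fun t => τ t = t).card = 2 := by
    rw [hfix, Finset.card_pair]
    intro h
    exact h2n (by linear_combination -h)
  have hsq : τ ^ 2 = 1 := by
    ext1 t
    rw [hτ, toPerm_genA_pow_mul_genB_sq_apply]
    push_cast
    rw [hkl]
    change _ = t
    linear_combination (l : ZMod (4 * n)) * hN
  have hne : τ ≠ 1 := by
    intro h
    rw [h] at hcard
    simp [ZMod.card] at hcard
    omega
  have hcount := cycleCount_mul_orderOf τ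
  rw [orderOf_eq_prime hsq hne, Finset.sum_range_succ, Finset.sum_range_one, pow_zero, pow_one,
    hcard] at hcount
  simp [ZMod.card] at hcount
  omega

end Group

/-! ### Convolution identities for the characters -/

section Characters

theorem linear_convolution {G : Type*} [Group G] [Fintype G] (φ : G →* ℂˣ) (h : G) :
    (φ 1 : ℂ) / (Fintype.card G : ℂ) * ∑ g, (φ g : ℂ) * (φ (g⁻¹ * h) : ℂ) = φ h := by
  have : ∀ g, (φ g : ℂ) * (φ (g⁻¹ * h) : ℂ) = φ h := fun g => by
    rw [← Units.val_mul, ← map_mul, mul_inv_cancel_left]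
  simp only [this, Finset.sum_const, Finset.card_univ, nsmul_eq_mul, map_one, Units.val_one]
  have hc : (Fintype.card G : ℂ) ≠ 0 := by exact_mod_cast Fintype.card_ne_zero
  field_simp

/-- Multiply the matrix identity `hρ` by `ρ h` and take traces. -/
theorem trace_convolution {G κ : Type*} [Group G] [Fintype G] [Fintype κ] [DecidableEq κ]
    (ρ : G →* GL κ ℂ) (c : ℂ)
    (hρ : c • ∑ g, (ρ g : Matrix κ κ ℂ).trace • (ρ g⁻¹ : Matrix κ κ ℂ) = 1) (h : G) :
    c * ∑ g, (ρ g : Matrix κ κ ℂ).trace * (ρ (g⁻¹ * h) : Matrix κ κ ℂ).trace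
      = (ρ h : Matrix κ κ ℂ).trace := by
  conv_rhs => rw [← one_mul (ρ h : Matrix κ κ ℂ), ← hρ]
  simp only [smul_mul_assoc, Finset.sum_mul, Matrix.trace_smul, Matrix.trace_sum, smul_eq_mul,
    map_mul, Units.val_mul]

theorem coe_rho_genA_pow (n : ℕ) [NeZero n] (h k : ℕ) :
    (rho n h (genA n ^ k) : Matrix (Fin 2) (Fin 2) ℂ)
      = !![(omega n ^ h) ^ k, 0; 0, (omega n ^ ((2 * n - 1) * h)) ^ k] := by
  rw [map_pow, rho, lift_genA, coe_matA_pow, pow_mul, pow_mul]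

theorem rhoChar_genA_pow (n : ℕ) [NeZero n] (h k : ℕ) :
    rhoChar n h (genA n ^ k) = (omega n ^ h) ^ k + (omega n ^ ((2 * n - 1) * h)) ^ k := by
  rw [rhoChar, coe_rho_genA_pow, Matrix.trace_fin_two_of]

theorem rhoChar_genA_pow_mul_genB (n : ℕ) [NeZero n] (h k : ℕ) :
    rhoChar n h (genA n ^ k * genB n) = 0 := by
  rw [rhoChar, map_mul, Units.val_mul, coe_rho_genA_pow, rho, lift_genB, coe_matB]
  simp [Matrix.trace_fin_two]

theorem coe_rho_genA_pow_inv (n : ℕ) [NeZero n] (h k : ℕ) :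
    (rho n h (genA n ^ k)⁻¹ : Matrix (Fin 2) (Fin 2) ℂ)
      = !![((omega n ^ h)⁻¹) ^ k, 0; 0, ((omega n ^ ((2 * n - 1) * h))⁻¹) ^ k] := by
  rw [map_inv]
  refine Units.inv_eq_of_mul_eq_one_right ?_
  have := omega_ne_zero n
  rw [coe_rho_genA_pow, Matrix.one_fin_two]
  simp [this]

/-- The terms `x ^ k` contribute `N`, and the others form a geometric sum over the nontrivial root
of unity `y / x`, which vanishes. -/
theorem geom_sum_orthogonality (N : ℕ) (x y : ℂ) (hx : x ^ N = 1) (hy : y ^ N = 1)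
    (hx0 : x ≠ 0) (hxy : x ≠ y) :
    ∑ k ∈ Finset.range N, (x ^ k + y ^ k) * (x⁻¹) ^ k = N := by
  have hz : y * x⁻¹ ≠ 1 := fun h => hxy (by
    rw [← div_eq_mul_inv, div_eq_one_iff_eq hx0] at h
    exact h.symm)
  have h : ∀ k, (x ^ k + y ^ k) * (x⁻¹) ^ k = 1 + (y * x⁻¹) ^ k := by
    intro k
    rw [add_mul, ← mul_pow, ← mul_pow, mul_inv_cancel₀ hx0, one_pow]
  simp_rw [h, Finset.sum_add_distrib]
  rw [geom_sum_eq hz, mul_pow, inv_pow, hx, hy]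
  simp

theorem omega_isPrimitiveRoot (n : ℕ) [NeZero n] : IsPrimitiveRoot (omega n) (4 * n) := by
  have hn := NeZero.pos n
  have h := Complex.isPrimitiveRoot_exp (4 * n) (by omega)
  have hn' : (n : ℂ) ≠ 0 := by exact_mod_cast hn.ne'
  have e : omega n = Complex.exp (2 * Real.pi * Complex.I / (4 * n : ℕ)) := by
    rw [omega]
    congr 1
    push_cast
    field_simp
    ring
  rw [e]
  exact h

/-- Equality would give `4n ∣ (2n - 2) h`, that is `2n ∣ (n - 1) h`. For even `n` the factor `n - 1`
is coprime to `2n`. -/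
theorem omega_pow_ne (n : ℕ) [NeZero n] (hn : Even n) (h : ℕ) (hh : ¬ 2 * n ∣ h) :
    omega n ^ h ≠ omega n ^ ((2 * n - 1) * h) := by
  intro e
  have hn0 := NeZero.pos n
  obtain ⟨r, hr⟩ := hn
  have e1 : (2 * n - 1) * h = h + (2 * n - 2) * h := by
    rw [show 2 * n - 1 = 1 + (2 * n - 2) by omega]; ring
  rw [e1, pow_add, left_eq_mul₀ (pow_ne_zero _ (omega_ne_zero n)),
    (omega_isPrimitiveRoot n).pow_eq_one_iff_dvd] at e
  have e2 : 2 * (2 * n) ∣ 2 * ((n - 1) * h) := by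
    have : 2 * ((n - 1) * h) = (2 * n - 2) * h := by
      rw [← mul_assoc, Nat.mul_sub_one]
    rw [this, ← mul_assoc]
    exact e
  have e3 := Nat.dvd_of_mul_dvd_mul_left (by norm_num) e2
  refine hh (Nat.Coprime.dvd_of_dvd_mul_left ?_ e3)
  refine Nat.Coprime.mul_left ?_ ?_
  · rw [Nat.coprime_two_left]
    exact ⟨r - 1, by omega⟩
  · have := (Nat.coprime_self_add_right (m := n - 1) (n := 1)).2 (by simp)
    rw [Nat.sub_add_cancel hn0] at this
    exact this.symm

/-- Only the `a ^ k` contribute to `∑ χ(g) ρ(g⁻¹)`. The sum is diagonal with both entries `4n` by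
orthogonality, and `2 / (8n)` normalizes it to the identity. -/
theorem rhoChar_convolution (n : ℕ) [NeZero n] (hn : Even n) (h : ℕ) (hh : ¬ 2 * n ∣ h)
    (g' : SD n) :
    rhoChar n h 1 / (Fintype.card (SD n) : ℂ) *
      ∑ g, rhoChar n h g * rhoChar n h (g⁻¹ * g') = rhoChar n h g' := by
  have hxy := omega_pow_ne n hn h hh
  have h1 : rhoChar n h 1 = 2 := by
    have := rhoChar_genA_pow n h 0
    simp only [pow_zero] at this
    rw [this]; norm_num
  refine trace_convolution (rho n h) _ ?_ g'
  change _ • ∑ g, rhoChar n h g • _ = _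
  have hω : ∀ j, (omega n ^ j) ^ (4 * n) = 1 := fun j => by
    rw [← pow_mul, mul_comm, pow_mul, omega_pow, one_pow]
  have hω0 : ∀ j, omega n ^ j ≠ 0 := fun j => pow_ne_zero _ (omega_ne_zero n)
  rw [sum_SD, card_SD, h1]
  simp only [rhoChar_genA_pow_mul_genB, zero_smul, Finset.sum_const_zero, add_zero,
    rhoChar_genA_pow, coe_rho_genA_pow_inv]
  have hx := geom_sum_orthogonality (4 * n) _ _ (hω h) (hω ((2 * n - 1) * h)) (hω0 _) hxy
  have hy := geom_sum_orthogonality (4 * n) _ _ (hω ((2 * n - 1) * h)) (hω h) (hω0 _) hxy.symm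
  have hc : (n : ℂ) ≠ 0 := by exact_mod_cast NeZero.ne n
  have hsum : ∑ k ∈ Finset.range (4 * n),
      ((omega n ^ h) ^ k + (omega n ^ ((2 * n - 1) * h)) ^ k) •
        !![((omega n ^ h)⁻¹) ^ k, 0; 0, ((omega n ^ ((2 * n - 1) * h))⁻¹) ^ k]
      = !![((4 * n : ℕ) : ℂ), 0; 0, ((4 * n : ℕ) : ℂ)] := by
    ext i j
    rw [Matrix.sum_apply]
    fin_cases i <;> fin_cases j
    · simpa using hx
    · simp
    · simp
    · simp_rw [add_comm ((omega n ^ ((2 * n - 1) * h)) ^ _)] at hy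
      simpa using hy
  rw [hsum, Matrix.one_fin_two]
  ext i j
  fin_cases i <;> fin_cases j <;> simp <;> field_simp <;> norm_num

end Characters

/-! ### Index sets and their reflections -/

section IndexSets

theorem mem_CdagEven (n k : ℕ) : k ∈ CdagEven n ↔ Even k ∧ 0 < k ∧ k < 2 * n := by
  simp only [CdagEven, C1, Finset.mem_sdiff, Finset.mem_filter, Finset.mem_range,
    Finset.mem_insert, Finset.mem_singleton]
  constructor
  · rintro ⟨⟨h1, h2⟩, h3⟩
    exact ⟨h2, by omega, by omega⟩
  · rintro ⟨h1, h2, h3⟩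
    exact ⟨⟨by omega, h1⟩, by omega⟩

theorem mem_CdagOdd (n k : ℕ) : k ∈ CdagOdd n ↔
    Odd k ∧ (k < n ∨ (2 * n < k ∧ k < 3 * n)) := by
  simp only [CdagOdd, C2even, C3even, Finset.mem_union, Finset.mem_filter, Finset.mem_Icc,
    Nat.odd_iff]
  omega

theorem two_mul_not_dvd_of_mem_CdagEven {n k : ℕ} (hk : k ∈ CdagEven n) : ¬ 2 * n ∣ k := by
  rw [mem_CdagEven] at hk
  exact fun h => (Nat.le_of_dvd hk.2.1 h).not_gt hk.2.2

theorem two_mul_not_dvd_of_odd {n k : ℕ} (hk : Odd k) : ¬ 2 * n ∣ k := fun h =>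
  (Nat.not_even_iff_odd.2 hk) (even_iff_two_dvd.2 (dvd_of_mul_right_dvd h))

/-- Multiplication by `2n - 1` on odd residues modulo `4n` is reflection at `n`. -/
theorem odd_mul_mod (n : ℕ) [NeZero n] (s : ℕ) (hs : Odd s) (hs4 : s < 4 * n) :
    s * (2 * n - 1) % (4 * n) = if s < 2 * n then 2 * n - s else 6 * n - s := by
  have hn := NeZero.pos n
  obtain ⟨q, rfl⟩ := hs
  obtain ⟨p, rfl⟩ : ∃ p, n = p + 1 := Nat.exists_eq_succ_of_ne_zero hn.ne'
  -- For odd `s`, `s (2n - 1) + s = 2ns` is congruent to `2n` modulo `4n`.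
  have e : ((2 * q + 1) * (2 * (p + 1) - 1) : ℕ) + (2 * q + 1)
      = 2 * (p + 1) + 4 * (p + 1) * q := by
    rw [show 2 * (p + 1) - 1 = 2 * p + 1 by omega]; ring
  split_ifs with h
  · have : (2 * q + 1) * (2 * (p + 1) - 1)
        = (2 * (p + 1) - (2 * q + 1)) + 4 * (p + 1) * q := by omega
    rw [this, Nat.add_mul_mod_self_left, Nat.mod_eq_of_lt (by omega)]
  · obtain ⟨u, rfl⟩ : ∃ u, q = u + 1 := ⟨q - 1, by omega⟩
    have e' : 4 * (p + 1) * (u + 1) = 4 * (p + 1) * u + 4 * (p + 1) := by ring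
    have : (2 * (u + 1) + 1) * (2 * (p + 1) - 1)
        = (6 * (p + 1) - (2 * (u + 1) + 1)) + 4 * (p + 1) * u := by omega
    rw [this, Nat.add_mul_mod_self_left, Nat.mod_eq_of_lt (by omega)]

/-- The reflections `s ↦ 2n - s` and `s ↦ 6n - s` carry the odd numbers below `n` to those in `(n,
2n)`, and those in `(2n, 3n)` to those in `(3n, 4n)`. Since `n` is even, no odd number equals `n` or
`3n`. -/
theorem CdagOdd_union_bar (n : ℕ) [NeZero n] (hn : Even n) :
    CdagOdd n ∪ bar n (CdagOdd n) = (Finset.range (4 * n)).filter fun k => ¬ Even k := by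
  have hn0 := NeZero.pos n
  rw [Nat.even_iff] at hn
  ext k
  simp only [Finset.mem_union, bar, Finset.mem_image, Finset.mem_filter, Finset.mem_range,
    Nat.not_even_iff_odd]
  constructor
  · rintro (h | ⟨s, hs, rfl⟩)
    · rw [mem_CdagOdd] at h
      exact ⟨by omega, h.1⟩
    · rw [mem_CdagOdd] at hs
      rw [odd_mul_mod n s hs.1 (by omega)]
      rw [Nat.odd_iff] at hs ⊢
      split_ifs <;> omega
  · rintro ⟨h1, h2⟩
    have h2' := Nat.odd_iff.1 h2
    rw [mem_CdagOdd]
    by_cases hk : k < n ∨ (2 * n < k ∧ k < 3 * n)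
    · exact Or.inl ⟨h2, hk⟩
    · right
      by_cases hk2 : k < 2 * n
      · have ho : Odd (2 * n - k) := Nat.odd_iff.2 (by omega)
        refine ⟨2 * n - k, (mem_CdagOdd _ _).2 ⟨ho, by omega⟩, ?_⟩
        rw [odd_mul_mod n _ ho (by omega), if_pos (by omega)]
        omega
      · have ho : Odd (6 * n - k) := Nat.odd_iff.2 (by omega)
        refine ⟨6 * n - k, (mem_CdagOdd _ _).2 ⟨ho, by omega⟩, ?_⟩
        rw [odd_mul_mod n _ ho (by omega), if_neg (by omega)]
        omega

/-- The involution `k ↦ 4n - k` modulo `4n` fixes `0` and `2n` and pairs the other even residues. -/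
theorem sum_range_filter_even {M : Type*} [CommRing M] (n : ℕ) [NeZero n] (f : ℕ → M)
    (hf : ∀ k ∈ CdagEven n, f (4 * n - k) = f k) :
    ∑ k ∈ (Finset.range (4 * n)).filter Even, f k
      = f 0 + f (2 * n) + 2 * ∑ k ∈ CdagEven n, f k := by
  have hn := NeZero.pos n
  have hset : (Finset.range (4 * n)).filter Even
      = ({0, 2 * n} : Finset ℕ) ∪ (CdagEven n ∪ (CdagEven n).image fun k => 4 * n - k) := by
    ext k
    simp only [Finset.mem_union, Finset.mem_image, Finset.mem_filter, Finset.mem_range,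
      Finset.mem_insert, Finset.mem_singleton, mem_CdagEven, Nat.even_iff]
    constructor
    · rintro ⟨h1, h2⟩
      by_cases h3 : k ≤ 2 * n
      · omega
      · exact Or.inr (Or.inr ⟨4 * n - k, by omega, by omega⟩)
    · rintro (h | h | ⟨j, h, rfl⟩) <;> omega
  rw [hset, Finset.sum_union, Finset.sum_union, Finset.sum_image, Finset.sum_congr rfl hf,
    Finset.sum_pair (by omega)]
  · ring
  · intro i hi j hj h
    simp only [Finset.mem_coe, mem_CdagEven] at hi hj
    have h' : 4 * n - i = 4 * n - j := h
    omega
  · rw [Finset.disjoint_left]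
    intro k hk hk'
    simp only [Finset.mem_image, mem_CdagEven] at hk hk'
    obtain ⟨j, hj, rfl⟩ := hk'
    omega
  · rw [Finset.disjoint_left]
    intro k hk hk'
    simp only [Finset.mem_insert, Finset.mem_singleton, Finset.mem_union, Finset.mem_image,
      mem_CdagEven] at hk hk'
    rcases hk' with hk' | ⟨j, hj, rfl⟩ <;> omega

theorem sum_range_filter_odd_eq_zero (n : ℕ) (f : ℕ → ℂ)
    (hf : ∀ k, Odd k → k < 4 * n → f (4 * n - k) = -f k) :
    ∑ k ∈ (Finset.range (4 * n)).filter (fun k => ¬ Even k), f k = 0 := by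
  have h : ∑ k ∈ (Finset.range (4 * n)).filter (fun k => ¬ Even k), f k
      = ∑ k ∈ (Finset.range (4 * n)).filter (fun k => ¬ Even k), -f k := by
    refine Finset.sum_nbij' (fun k => 4 * n - k) (fun k => 4 * n - k) ?_ ?_ ?_ ?_ ?_
    all_goals
      intro k hk
      simp only [Finset.mem_filter, Finset.mem_range, Nat.not_even_iff_odd] at hk ⊢
      have hk2 := hk.2
      rw [Nat.odd_iff] at hk2
    · rw [Nat.odd_iff]; omega
    · rw [Nat.odd_iff]; omega
    · omega
    · omega
    · rw [hf k hk.2 hk.1, neg_neg]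
  rw [Finset.sum_neg_distrib] at h
  exact CharZero.eq_neg_self_iff.1 h

theorem sum_range_two_mul {M : Type*} [AddCommMonoid M] (N : ℕ) (f : ℕ → M) :
    ∑ k ∈ Finset.range (2 * N), f k
      = ∑ i ∈ Finset.range N, f (2 * i) + ∑ i ∈ Finset.range N, f (2 * i + 1) := by
  induction N with
  | zero => simp
  | succ N ih =>
    rw [mul_add, mul_one, Finset.sum_range_succ, Finset.sum_range_succ, ih,
      Finset.sum_range_succ, Finset.sum_range_succ]
    abel

theorem sum_range_eq_even_add_odd (n : ℕ) (f : ℕ → ℂ) :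
    ∑ k ∈ Finset.range (4 * n), f k = ∑ k ∈ (Finset.range (4 * n)).filter Even, f k
      + ∑ k ∈ (Finset.range (4 * n)).filter (fun k => ¬ Even k), f k :=
  (Finset.sum_filter_add_sum_filter_not _ _ _).symm

theorem gcd_sub_self_left {N k : ℕ} (hk : k ≤ N) : Nat.gcd N (N - k) = Nat.gcd N k :=
  Nat.gcd_self_sub_right hk

end IndexSets

/-! ### Dimension formulas in terms of character values -/

section Dimensions

variable (n : ℕ) [NeZero n] (V : Type*) [AddCommGroup V] [Module ℂ V] [FiniteDimensional ℂ V]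

theorem linearChar_genA_pow (x y : ℂˣ) (hx : x ^ 2 = 1) (hy : y ^ 2 = 1) (k : ℕ) :
    linearChar n x y hx hy (genA n ^ k) = x ^ k := by
  rw [map_pow, linearChar, lift_genA]

theorem linearChar_genA_pow_mul_genB (x y : ℂˣ) (hx : x ^ 2 = 1) (hy : y ^ 2 = 1) (k : ℕ) :
    linearChar n x y hx hy (genA n ^ k * genB n) = x ^ k * y := by
  rw [map_mul, linearChar_genA_pow, linearChar, lift_genB]

/-- Among the `a ^ k b` there are `2n` of each parity of `k`; as `x ^ 2 = 1`, the character is `y`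
for even `k` and `x y` for odd `k`. -/
theorem finrank_symmetryClass_linearChar (hn : Even n)
    (x y : ℂˣ) (hx : x ^ 2 = 1) (hy : y ^ 2 = 1) :
    (Module.finrank ℂ
        (symmetryClass (toPerm n) (fun g => (linearChar n x y hx hy g : ℂ)) V) : ℂ) =
      1 / (8 * n) * (∑ k ∈ Finset.range (4 * n),
          (x : ℂ) ^ k * (Module.finrank ℂ V : ℂ) ^ Nat.gcd (4 * n) k
        + 2 * n * y * ((Module.finrank ℂ V : ℂ) ^ (2 * n + 1)
          + x * (Module.finrank ℂ V : ℂ) ^ n)) := by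
  have hx2 : ∀ i, x ^ (2 * i) = 1 := fun i => by rw [pow_mul, hx, one_pow]
  have hb : ∑ k ∈ Finset.range (4 * n), (linearChar n x y hx hy (genA n ^ k * genB n) : ℂ)
      * (Module.finrank ℂ V : ℂ) ^ cycleCount (toPerm n (genA n ^ k * genB n))
      = 2 * n * y * ((Module.finrank ℂ V : ℂ) ^ (2 * n + 1)
          + x * (Module.finrank ℂ V : ℂ) ^ n) := by
    rw [show Finset.range (4 * n) = Finset.range (2 * (2 * n)) by congr 1; ring,
      sum_range_two_mul]
    simp only [linearChar_genA_pow_mul_genB, cycleCount_of_even n hn _ (even_two_mul _),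
      cycleCount_of_odd n _ (odd_two_mul_add_one _), pow_succ x, hx2, one_mul, Units.val_mul,
      Finset.sum_const, Finset.card_range, nsmul_eq_mul]
    push_cast
    ring
  rw [finrank_symmetryClass _ _ _ (linear_convolution _), card_SD, sum_SD, hb]
  simp only [linearChar_genA_pow, cycleCount_genA_pow, map_one, Units.val_one,
    Units.val_pow_eq_pow_val]
  push_cast
  rfl

/-- The product of the two eigenvalues is `ω ^ (2nhk)`. It equals 1 when `hk` is even, so they are
mutually inverse and their sum is twice a cosine. -/
theorem two_mul_cos_eq (h k : ℕ) (hh : Even h ∨ Even k) :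
    (omega n ^ h) ^ k + (omega n ^ ((2 * n - 1) * h)) ^ k
      = 2 * Complex.cos (h * k * Real.pi / (2 * n)) := by
  have hn := NeZero.pos n
  have hne := omega_ne_zero n
  have hn' : (n : ℂ) ≠ 0 := by exact_mod_cast hn.ne'
  have hE : Even (h * k) := by rcases hh with h | h <;> simp [h]
  obtain ⟨c, hc⟩ := hE
  have h1 : omega n ^ (h * k) = Complex.exp (h * k * Real.pi / (2 * n) * Complex.I) := by
    rw [omega, ← Complex.exp_nat_mul]
    congr 1
    push_cast
    field_simp
  have h2 : omega n ^ ((2 * n - 1) * h * k)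
      = Complex.exp (-(h * k * Real.pi / (2 * n)) * Complex.I) := by
    have e : (2 * n - 1) * h * k + h * k = 4 * n * c := by
      rw [mul_assoc, ← Nat.succ_mul, Nat.succ_eq_add_one, Nat.sub_add_cancel (by omega), hc]
      ring
    have : omega n ^ ((2 * n - 1) * h * k) * omega n ^ (h * k) = 1 := by
      rw [← pow_add, e, pow_mul, omega_pow, one_pow]
    rw [neg_mul, Complex.exp_neg, ← h1]
    exact eq_inv_of_mul_eq_one_left this
  rw [← pow_mul, ← pow_mul, h1, h2, Complex.two_cos]

/-- For `h` and `k` odd the eigenvalues `x, y` of `ρ^h(a^k)` satisfy `x y = -1`, so `x⁻¹ + y⁻¹ = (x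
+ y) / (x y) = -(x + y)`. -/
theorem rhoChar_genA_pow_reflect (h k : ℕ) (hh : Odd h) (hk : Odd k) (hk4 : k < 4 * n) :
    rhoChar n h (genA n ^ (4 * n - k)) = -rhoChar n h (genA n ^ k) := by
  have hn := NeZero.pos n
  have hne := omega_ne_zero n
  have hω : ∀ j, (omega n ^ j) ^ (4 * n) = 1 := fun j => by
    rw [← pow_mul, mul_comm, pow_mul, omega_pow, one_pow]
  have hrefl : ∀ j, (omega n ^ j) ^ (4 * n - k) = ((omega n ^ j) ^ k)⁻¹ := fun j => by
    rw [pow_sub₀ _ (pow_ne_zero _ hne) hk4.le, hω, one_mul]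
  have hhalf : omega n ^ (2 * n) = -1 := by
    have := (omega_isPrimitiveRoot n).pow_ne_one_of_pos_of_lt (l := 2 * n) (by omega) (by omega)
    have h2 : (omega n ^ (2 * n)) ^ 2 = 1 := by
      rw [← pow_mul, show 2 * n * 2 = 4 * n by ring, omega_pow]
    exact (mul_self_eq_one_iff.1 (by rw [← sq]; exact h2)).resolve_left this
  have hprod : (omega n ^ h) ^ k * (omega n ^ ((2 * n - 1) * h)) ^ k = -1 := by
    rw [← mul_pow, ← pow_add, ← pow_mul]
    have e : (h + (2 * n - 1) * h) * k = 2 * n * (h * k) := by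
      rw [add_comm, ← Nat.succ_mul, Nat.succ_eq_add_one, Nat.sub_add_cancel (by omega)]
      ring
    rw [e, pow_mul, hhalf, (hh.mul hk).neg_one_pow]
  rw [rhoChar_genA_pow, rhoChar_genA_pow, hrefl, hrefl]
  have hx : (omega n ^ h) ^ k ≠ 0 := pow_ne_zero _ (pow_ne_zero _ hne)
  have hy : (omega n ^ ((2 * n - 1) * h)) ^ k ≠ 0 := pow_ne_zero _ (pow_ne_zero _ hne)
  field_simp
  rw [hprod]
  ring

theorem finrank_symmetryClass_rhoChar (hn : Even n) (h : ℕ) (hh : ¬ 2 * n ∣ h) :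
    (Module.finrank ℂ (symmetryClass (toPerm n) (rhoChar n h) V) : ℂ) =
      1 / (4 * n) * ∑ k ∈ Finset.range (4 * n),
        rhoChar n h (genA n ^ k) * (Module.finrank ℂ V : ℂ) ^ Nat.gcd (4 * n) k := by
  have h1 : rhoChar n h 1 = 2 := by
    have := rhoChar_genA_pow n h 0
    simp only [pow_zero] at this
    rw [this]; norm_num
  rw [finrank_symmetryClass _ _ _ (rhoChar_convolution n hn h hh), card_SD, sum_SD, h1]
  simp only [rhoChar_genA_pow_mul_genB, zero_mul, Finset.sum_const_zero, add_zero,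
    cycleCount_genA_pow]
  have hn' : (n : ℂ) ≠ 0 := by exact_mod_cast NeZero.ne n
  congr 1
  push_cast
  field_simp
  norm_num

/-- The alternating sum of `m ^ gcd(4n, k)`. -/
theorem sum_neg_one_pow (hn : Even n) (m : ℂ) :
    ∑ k ∈ Finset.range (4 * n), (-1 : ℂ) ^ k * m ^ Nat.gcd (4 * n) k
      = m ^ (4 * n) + m ^ (2 * n) + 2 * ∑ k ∈ CdagEven n, m ^ Nat.gcd (4 * n) k
        - ∑ k ∈ CdagOdd n ∪ bar n (CdagOdd n), m ^ Nat.gcd (4 * n) k := by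
  have he : ∑ k ∈ (Finset.range (4 * n)).filter Even, (-1 : ℂ) ^ k * m ^ Nat.gcd (4 * n) k
      = ∑ k ∈ (Finset.range (4 * n)).filter Even, m ^ Nat.gcd (4 * n) k :=
    Finset.sum_congr rfl fun k hk => by
      rw [(Finset.mem_filter.1 hk).2.neg_one_pow, one_mul]
  have ho : ∑ k ∈ (Finset.range (4 * n)).filter (fun k => ¬ Even k),
        (-1 : ℂ) ^ k * m ^ Nat.gcd (4 * n) k
      = -∑ k ∈ (Finset.range (4 * n)).filter (fun k => ¬ Even k), m ^ Nat.gcd (4 * n) k := by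
    rw [← Finset.sum_neg_distrib]
    exact Finset.sum_congr rfl fun k hk => by
      rw [(Nat.not_even_iff_odd.1 (Finset.mem_filter.1 hk).2).neg_one_pow, neg_one_mul]
  rw [sum_range_eq_even_add_odd, he, ho, CdagOdd_union_bar n hn, sum_range_filter_even n
    (fun k => m ^ Nat.gcd (4 * n) k), Nat.gcd_zero_right, show 4 * n = 2 * (2 * n) by ring,
    Nat.gcd_mul_left_left]
  · ring
  · intro k hk
    rw [mem_CdagEven] at hk
    rw [gcd_sub_self_left (by omega)]

end Dimensions

end SemiDihedral

end

/-! ### The six dimension formulas -/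

theorem theorem2p9 (n : ℕ) [NeZero n] (hn : Even n)
    (V : Type*) [NormedAddCommGroup V] [InnerProductSpace ℂ V] [FiniteDimensional ℂ V]
    (m : ℕ) (hm : Module.finrank ℂ V = m) :
    ((Module.finrank ℂ
        (SemiDihedral.symmetryClass (SemiDihedral.toPerm n) (SemiDihedral.chi0 n) V) : ℝ) =
      1 / (8 * n) * (2 * n * (m : ℝ) ^ n + 2 * n * (m : ℝ) ^ (2 * n + 1)
        + ∑ k ∈ Finset.range (4 * n), (m : ℝ) ^ Nat.gcd (4 * n) k)) ∧
    ((Module.finrank ℂ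
        (SemiDihedral.symmetryClass (SemiDihedral.toPerm n) (SemiDihedral.chi1 n) V) : ℝ) =
      1 / (8 * n) * (-(2 * n * (m : ℝ) ^ n) - 2 * n * (m : ℝ) ^ (2 * n + 1)
        + ∑ k ∈ Finset.range (4 * n), (m : ℝ) ^ Nat.gcd (4 * n) k)) ∧
    ((Module.finrank ℂ
        (SemiDihedral.symmetryClass (SemiDihedral.toPerm n) (SemiDihedral.chi2 n) V) : ℝ) =
      1 / (8 * n) * ((m : ℝ) ^ (4 * n) + (m : ℝ) ^ (2 * n)
        + 2 * ∑ k ∈ SemiDihedral.CdagEven n, (m : ℝ) ^ Nat.gcd (4 * n) k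
        - ∑ k ∈ SemiDihedral.CdagOdd n ∪ SemiDihedral.bar n (SemiDihedral.CdagOdd n),
            (m : ℝ) ^ Nat.gcd (4 * n) k
        + 2 * n * (m : ℝ) ^ (2 * n + 1) - 2 * n * (m : ℝ) ^ n)) ∧
    ((Module.finrank ℂ
        (SemiDihedral.symmetryClass (SemiDihedral.toPerm n) (SemiDihedral.chi3 n) V) : ℝ) =
      1 / (8 * n) * ((m : ℝ) ^ (4 * n) + (m : ℝ) ^ (2 * n)
        + 2 * ∑ k ∈ SemiDihedral.CdagEven n, (m : ℝ) ^ Nat.gcd (4 * n) k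
        - ∑ k ∈ SemiDihedral.CdagOdd n ∪ SemiDihedral.bar n (SemiDihedral.CdagOdd n),
            (m : ℝ) ^ Nat.gcd (4 * n) k
        - 2 * n * (m : ℝ) ^ (2 * n + 1) + 2 * n * (m : ℝ) ^ n)) ∧
    (∀ h ∈ SemiDihedral.CdagEven n,
      (Module.finrank ℂ
        (SemiDihedral.symmetryClass (SemiDihedral.toPerm n) (SemiDihedral.rhoChar n h) V) : ℝ) =
      1 / (2 * n) * ∑ k ∈ Finset.range (4 * n),
        (m : ℝ) ^ Nat.gcd (4 * n) k * Real.cos (h * k * Real.pi / (2 * n))) ∧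
    (∀ h' ∈ SemiDihedral.CdagOdd n,
      (Module.finrank ℂ
        (SemiDihedral.symmetryClass (SemiDihedral.toPerm n) (SemiDihedral.rhoChar n h') V) : ℝ) =
      1 / (4 * n) * (2 * (m : ℝ) ^ (4 * n) - 2 * (m : ℝ) ^ (2 * n)
        + 4 * ∑ k ∈ SemiDihedral.CdagEven n,
            (m : ℝ) ^ Nat.gcd (4 * n) k * Real.cos (h' * k * Real.pi / (2 * n)))) := by
  subst hm
  have hn0 := NeZero.pos n
  have hn' : (n : ℂ) ≠ 0 := by exact_mod_cast hn0.ne'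
  refine ⟨?_, ?_, ?_, ?_, ?_, ?_⟩
  · apply Complex.ofReal_injective
    push_cast
    refine (SemiDihedral.finrank_symmetryClass_linearChar n V hn 1 1 _ _).trans ?_
    simp only [Units.val_one, one_pow, one_mul]
    ring
  · apply Complex.ofReal_injective
    push_cast
    refine (SemiDihedral.finrank_symmetryClass_linearChar n V hn 1 (-1) _ _).trans ?_
    simp only [Units.val_one, Units.val_neg, one_pow, one_mul]
    ring
  · apply Complex.ofReal_injective
    push_cast
    refine (SemiDihedral.finrank_symmetryClass_linearChar n V hn (-1) 1 _ _).trans ?_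
    simp only [Units.val_one, Units.val_neg]
    rw [SemiDihedral.sum_neg_one_pow n hn]
    ring
  · apply Complex.ofReal_injective
    push_cast
    refine (SemiDihedral.finrank_symmetryClass_linearChar n V hn (-1) (-1) _ _).trans ?_
    simp only [Units.val_one, Units.val_neg]
    rw [SemiDihedral.sum_neg_one_pow n hn]
    ring
  · intro h hh
    apply Complex.ofReal_injective
    push_cast
    rw [SemiDihedral.finrank_symmetryClass_rhoChar n V hn h
      (SemiDihedral.two_mul_not_dvd_of_mem_CdagEven hh), Finset.mul_sum, Finset.mul_sum]
    refine Finset.sum_congr rfl fun k _ => ?_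
    rw [SemiDihedral.rhoChar_genA_pow,
      SemiDihedral.two_mul_cos_eq n h k (Or.inl ((SemiDihedral.mem_CdagEven n h).1 hh).1)]
    field_simp
    ring
  · intro h hh
    have hodd := ((SemiDihedral.mem_CdagOdd n h).1 hh).1
    apply Complex.ofReal_injective
    push_cast
    -- The terms with odd `k` cancel in pairs under `k ↦ 4n - k`; for even `k` the character value
    -- is twice a cosine although `h` is odd.
    rw [SemiDihedral.finrank_symmetryClass_rhoChar n V hn h
      (SemiDihedral.two_mul_not_dvd_of_odd hodd), SemiDihedral.sum_range_eq_even_add_odd,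
      SemiDihedral.sum_range_filter_odd_eq_zero, add_zero]
    · have hcos : ∑ k ∈ (Finset.range (4 * n)).filter Even,
          SemiDihedral.rhoChar n h (SemiDihedral.genA n ^ k)
            * (Module.finrank ℂ V : ℂ) ^ Nat.gcd (4 * n) k
          = ∑ k ∈ (Finset.range (4 * n)).filter Even, 2 * ((Module.finrank ℂ V : ℂ) ^
            Nat.gcd (4 * n) k * Complex.cos (h * k * Real.pi / (2 * n))) :=
        Finset.sum_congr rfl fun k hk => by
          rw [SemiDihedral.rhoChar_genA_pow,
            SemiDihedral.two_mul_cos_eq n h k (Or.inr (Finset.mem_filter.1 hk).2)]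
          ring
      have hgcd : Nat.gcd (4 * n) (2 * n) = 2 * n :=
        Nat.gcd_eq_right ⟨2, by ring⟩
      -- The term `k = 2n` gives `cos (hπ) = -1` for odd `h`, the source of `-2 m ^ (2n)`.
      have hpi : Complex.cos (h * ((2 * n : ℕ) : ℂ) * Real.pi / (2 * n)) = -1 := by
        have : (h * ((2 * n : ℕ) : ℂ) * Real.pi / (2 * n)) = h * Real.pi := by
          push_cast
          field_simp
        rw [this, ← Complex.ofReal_natCast, ← Complex.ofReal_mul, ← Complex.ofReal_cos,
          Real.cos_nat_mul_pi, hodd.neg_one_pow]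
        norm_num
      rw [hcos, ← Finset.mul_sum, SemiDihedral.sum_range_filter_even n
        (fun k => (Module.finrank ℂ V : ℂ) ^ Nat.gcd (4 * n) k
          * Complex.cos (h * k * Real.pi / (2 * n))), hgcd, hpi, Nat.gcd_zero_right]
      · simp only [Nat.cast_zero, mul_zero, zero_mul, zero_div, Complex.cos_zero]
        ring
      · intro k hk
        rw [SemiDihedral.mem_CdagEven] at hk
        rw [SemiDihedral.gcd_sub_self_left (by omega)]
        have e : (h * ((4 * n - k : ℕ) : ℂ) * Real.pi / (2 * n))
            = h * (2 * Real.pi) - h * k * Real.pi / (2 * n) := by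
          rw [Nat.cast_sub (by omega)]
          push_cast
          field_simp
          ring
        rw [e, Complex.cos_nat_mul_two_pi_sub]
    · intro k hk hk4
      rw [SemiDihedral.gcd_sub_self_left hk4.le,
        SemiDihedral.rhoChar_genA_pow_reflect n h k hodd hk hk4, neg_mul]
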